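/- A represented space $\mathbf X=(X,\delta_X)$ is a set $X$ with a partial surjection $\delta_X:\subseteq\{0,1\}^{\mathbb N}\to X$; $p$ is a name of $x$ if $\delta_X(p)=x$. A partial map $f:\subseteq\mathbf X\to\mathbf Y$ is computable if some computable (by a Type-2 machine) $F:\subseteq\{0,1\}^{\mathbb N}\to\{0,1\}^{\mathbb N}$ is a realizer of it, i.e. $\delta_Y(F(p))=f(\delta_X(p))$ for all $p\in\operatorname{dom}(f\circ\delta_X)$. Products carry the representation by pairs of names. $\mathcal C(\mathbf X,\mathbf Y)$ is the represented space of the functions $f:X\to Y$ with a continuous realizer, where $0^n1p$ is a name of $f$ if the $n$-th machine with oracle $p$ computes a realizer of $f$. $\mathbb N$ is represented by $0^n10^{\mathbb N}\mapsto n$. $\mathbb S=\{\bot,\top\}$ is represented by $0^{\mathbb N}\mapsto\bot$ and $p\mapsto\top$ for $p\ne 0^{\mathbb N}$. $\mathcal O(\mathbf X)$ is the represented space of the sets $U\subseteq X$ whose characteristic function belongs to $\mathcal C(\mathbf X,\mathbb S)$, named by the names of that function; these are the open sets of the quotient topology that $\delta_X$ induces on $X$, and $\overline A$ is the closure of $A$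 in this topology. $\mathcal V(\mathbf X)$ is the represented space of the closed subsets $A$ of $X$, where the names of $A$ are the names of $\{U\in\mathcal O(\mathbf X)\mid U\cap A\neq\emptyset\}\in\mathcal O(\mathcal O(\mathbf X))$. $\mathbf Z$ is computably overt if the map $\mathcal O(\mathbf Z)\to\mathbb S$ that sends $\emptyset$ to $\bot$ and every non-empty open set to $\top$ is computable. **Proposition.** Let $\mathbf X,\mathbf Y,\mathbf Z$ be represented spaces, and let $\mathbf Z$ be computably overt. Then the following functions are well-defined and computable: 1. $U\mapsto\overline U:\mathcal O(\mathbf Z)\to\mathcal V(\mathbf Z)$; 2. $x\mapsto\overline{\{x\}}:\mathbf X\to\mathcal V(\mathbf X)$; 3. $(A,B)\mapsto A\cup B:\mathcal V(\mathbf X)\times\mathcal V(\mathbf X)\to\mathcal V(\mathbf X)$; 4. $(A_n)_{n\in\mathbb N}\mapsto\overline{\bigcup_{n}A_n}:\mathcal C(\mathbb N,\mathcal V(\mathbf X))\to\mathcal V(\mathbf X)$; 5. $(A,U)\mapsto\overline{A\cap U}:\mathcal V(\mathbf X)\times\mathcal O(\mathbf X)\to\mathcal V(\mathbf X)$; 6.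 $A\mapsto\overline{\pi_1[A]}:\mathcal V(\mathbf X\times\mathbf Y)\to\mathcal V(\mathbf X)$; 7. $(f,A)\mapsto\overline{f[A]}:\mathcal C(\mathbf X,\mathbf Y)\times\mathcal V(\mathbf X)\to\mathcal V(\mathbf Y)$; 8. the partial map $(F,A)\mapsto\overline{f^{-1}(A)}:\subseteq\mathcal C(\mathcal O(\mathbf X),\mathcal O(\mathbf Y))\times\mathcal V(\mathbf Y)\to\mathcal V(\mathbf X)$, defined for those $(F,A)$ for which there is a function $f:X\to Y$ with $F(U)=f[U]$ for all $U\in\mathcal O(\mathbf X)$ (the value does not depend on the choice of $f$). -/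

import Mathlib

universe u v w

/-- Cantor space `{0,1}^ℕ` (with the product topology). -/
abbrev Cantor : Type := ℕ → Bool

namespace Cantor

/-- The finite word `p 0, …, p (m - 1)`. -/
def initial (p : Cantor) (m : ℕ) : List Bool := (List.range m).map p

/-- The interleaved pair `⟨p, q⟩ = p 0, q 0, p 1, q 1, …`. -/
def pair (p q : Cantor) : Cantor := fun k => if k % 2 = 0 then p (k / 2) else q (k / 2)

/-- The sequence `0^n 1 p`. -/
def prepend (n : ℕ) (p : Cantor) : Cantor :=
  fun k => if k < n then false else if k = n then true else p (k - (n + 1))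

theorem prepend_inj {n n' : ℕ} {p p' : Cantor} (h : prepend n p = prepend n' p') :
    n = n' ∧ p = p' := by
  have key : ∀ {a b : ℕ} {s t : Cantor}, prepend a s = prepend b t → ¬ a < b := by
    intro a b s t hab hlt
    have := congrFun hab a
    simp [prepend, hlt] at this
  have hn : n = n' := by
    have h1 := key h
    have h2 := key h.symm
    omega
  subst hn
  refine ⟨rfl, funext fun k => ?_⟩
  have := congrFun h (n + 1 + k)
  simpa [prepend, show ¬ (n + 1 + k < n) by omega, show ¬ (n + 1 + k = n) by omega] using this

end Cantor

/-! ### Type-2 machines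

A machine is given by a partial recursive program `c`. To determine cell `k` of the output tape, it
reads its input tape from left to right: whenever the word `σ` has been read, `c` is run on
`(σ, k)`. The answer `none` is the instruction to read one more symbol, the answer `some b` writes
the bit `b` into cell `k`. (If `c` diverges, or asks for more symbols forever, cell `k` is never
written.) A machine with oracle `p` and input `q` is a machine with the input tape `⟨p, q⟩`. -/

/-- On input tape `p`, the machine `c` writes the bit `b` into cell `k` of its output tape. -/
def MachineWrites (c : Nat.Partrec.Code) (p : Cantor) (k : ℕ) (b : Bool) : Prop :=
  ∃ m : ℕ,
    (∀ j < m, Encodable.encode (none : Option Bool) ∈ c.eval (Encodable.encode (p.initial j, k))) ∧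
    Encodable.encode (some b) ∈ c.eval (Encodable.encode (p.initial m, k))

theorem MachineWrites.unique {c : Nat.Partrec.Code} {p : Cantor} {k : ℕ} {b b' : Bool}
    (h : MachineWrites c p k b) (h' : MachineWrites c p k b') : b = b' := by
  obtain ⟨m, h1, h2⟩ := h
  obtain ⟨m', h1', h2'⟩ := h'
  rcases lt_trichotomy m m' with hlt | rfl | hlt
  · exact absurd (Encodable.encode_injective (Part.mem_unique h2 (h1' m hlt))) (by simp)
  · simpa using Encodable.encode_injective (Part.mem_unique h2 h2')
  · exact absurd (Encodable.encode_injective (Part.mem_unique h2' (h1 m' hlt))) (by simp)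

/-- The partial function on Cantor space computed by the machine `c`: it is defined at `p` iff all
cells of the output tape are written on input `p`, and its value is then the output tape. -/
noncomputable def machineMap (c : Nat.Partrec.Code) : Cantor →. Cantor := fun p =>
  ⟨∀ k, ∃ b, MachineWrites c p k b, fun h k => (h k).choose⟩

theorem mem_machineMap {c : Nat.Partrec.Code} {p q : Cantor} :
    q ∈ machineMap c p ↔ ∀ k, MachineWrites c p k (q k) := by
  constructor
  · rintro ⟨h, rfl⟩ k
    exact (h k).choose_spec
  · intro h
    exact ⟨fun k => ⟨q k, h k⟩, funext fun k => (Exists.choose_spec (⟨q k, h k⟩ :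
      ∃ b, MachineWrites c p k b)).unique (h k)⟩

/-- A represented space: a set with a partial surjection from Cantor space onto it, given by its
graph (`IsName p x` says that the representation is defined at `p` with the value `x`). -/
structure RepSpace where
  carrier : Type u
  IsName : Cantor → carrier → Prop
  unique : ∀ {p x y}, IsName p x → IsName p y → x = y
  surj : ∀ x, ∃ p, IsName p x

namespace RepSpace

instance : CoeSort RepSpace.{u} (Type u) := ⟨RepSpace.carrier⟩

/-- `F` realizes the partial map `f`. -/
def IsRealizer (X : RepSpace.{u}) (Y : RepSpace.{v}) (F : Cantor →. Cantor) (f : X →. Y) : Prop :=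
  ∀ p x y, X.IsName p x → y ∈ f x → ∃ q ∈ F p, Y.IsName q y

/-- A partial map between represented spaces is computable iff it has a computable realizer. -/
def IsComputablePartial (X : RepSpace.{u}) (Y : RepSpace.{v}) (f : X →. Y) : Prop :=
  ∃ c : Nat.Partrec.Code, IsRealizer X Y (machineMap c) f

/-- Computability of a total map. -/
def IsComputable (X : RepSpace.{u}) (Y : RepSpace.{v}) (f : X → Y) : Prop :=
  IsComputablePartial X Y (PFun.lift f)

/-- The representation, as a function on its domain. -/
noncomputable def delta (X : RepSpace.{u}) (p : {p : Cantor // ∃ x, X.IsName p x}) : X :=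
  p.2.choose

theorem delta_eq (X : RepSpace.{u}) {p : Cantor} {x : X} (h : X.IsName p x) :
    X.delta ⟨p, x, h⟩ = x :=
  X.unique (Exists.choose_spec (⟨x, h⟩ : ∃ x, X.IsName p x)) h

/-- The quotient topology of the representation on its set of values. -/
@[reducible] noncomputable def topology (X : RepSpace.{u}) : TopologicalSpace X :=
  TopologicalSpace.coinduced X.delta inferInstance

/-- `0^n 1 p` is a name of `f : X → Y` iff the `n`-th machine with oracle `p` computes a
realizer of `f`. -/
def IsFunName (X : RepSpace.{u}) (Y : RepSpace.{v}) (r : Cantor) (f : X → Y) : Prop :=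
  ∃ (n : ℕ) (p : Cantor), r = Cantor.prepend n p ∧
    IsRealizer X Y (fun q => machineMap (Denumerable.ofNat Nat.Partrec.Code n) (p.pair q)) f

theorem IsFunName.unique {X : RepSpace.{u}} {Y : RepSpace.{v}} {r : Cantor} {f g : X → Y}
    (hf : IsFunName X Y r f) (hg : IsFunName X Y r g) : f = g := by
  obtain ⟨n, p, rfl, hf⟩ := hf
  obtain ⟨n', p', hr, hg⟩ := hg
  obtain ⟨rfl, rfl⟩ := Cantor.prepend_inj hr
  funext x
  obtain ⟨q, hq⟩ := X.surj x
  obtain ⟨s, hs, hs'⟩ := hf q x (f x) hq (Part.mem_some _)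
  obtain ⟨t, ht, ht'⟩ := hg q x (g x) hq (Part.mem_some _)
  obtain rfl := Part.mem_unique hs ht
  exact Y.unique hs' ht'

/-- The product `X × Y`: a name is an interleaved pair of names. -/
def prod (X : RepSpace.{u}) (Y : RepSpace.{v}) : RepSpace.{max u v} where
  carrier := X × Y
  IsName r z := ∃ p q, r = Cantor.pair p q ∧ X.IsName p z.1 ∧ Y.IsName q z.2
  unique := by
    have key : ∀ {p q p' q' : Cantor}, p.pair q = p'.pair q' → p = p' ∧ q = q' := by
      intro p q p' q' h
      constructor
      · funext k
        have := congrFun h (2 * k)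
        simpa [Cantor.pair] using this
      · funext k
        have := congrFun h (2 * k + 1)
        simpa [Cantor.pair, show (2 * k + 1) / 2 = k by omega] using this
    rintro r x y ⟨p, q, rfl, hp, hq⟩ ⟨p', q', h, hp', hq'⟩
    obtain ⟨rfl, rfl⟩ := key h
    exact Prod.ext (X.unique hp hp') (Y.unique hq hq')
  surj z := by
    obtain ⟨p, hp⟩ := X.surj z.1
    obtain ⟨q, hq⟩ := Y.surj z.2
    exact ⟨_, p, q, rfl, hp, hq⟩

/-- The natural numbers: `0^n 1 0^ℕ` is the name of `n`. -/
def nat : RepSpace.{0} where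
  carrier := ℕ
  IsName p n := p = Cantor.prepend n (fun _ => false)
  unique := by
    rintro _ x y rfl h
    exact (Cantor.prepend_inj h).1
  surj n := ⟨_, rfl⟩

/-- Sierpiński space, with `⊥ = False` and `⊤ = True`: `0^ℕ` is the only name of `⊥`, and every
other sequence is a name of `⊤`. -/
def sierpinski : RepSpace.{0} where
  carrier := Prop
  IsName p s := s ↔ ∃ n, p n = true
  unique h h' := propext (h.trans h'.symm)
  surj s := by
    by_cases h : s
    · exact ⟨fun _ => true, by simp [h]⟩
    · exact ⟨fun _ => false, by simp [h]⟩

/-- The function space `𝒞(X, Y)`: the functions that have a name. -/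
def functions (X : RepSpace.{u}) (Y : RepSpace.{v}) : RepSpace.{max u v} where
  carrier := {f : X → Y // ∃ r, IsFunName X Y r f}
  IsName r f := IsFunName X Y r f.1
  unique h h' := Subtype.ext (h.unique h')
  surj f := f.2

/-- The characteristic function of a subset, with values in Sierpiński space. -/
def char (X : RepSpace.{u}) (U : Set X) : X → sierpinski := fun x => (x ∈ U : Prop)

/-- The space `𝒪(X)` of open sets: `U` is identified with its characteristic function in
`𝒞(X, 𝕊)`. -/
def opens (X : RepSpace.{u}) : RepSpace.{u} where
  carrier := {U : Set X // ∃ r, IsFunName X sierpinski r (X.char U)}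
  IsName r U := IsFunName X sierpinski r (X.char U.1)
  unique h h' :=
    Subtype.ext (Set.ext fun x => iff_of_eq (congrFun (IsFunName.unique h h') x))
  surj U := U.2

end RepSpace
namespace Cantor

theorem length_initial (p : Cantor) (m : ℕ) : (p.initial m).length = m := by
  simp [initial]

theorem getD_initial (p : Cantor) {m i : ℕ} (h : i < m) : (p.initial m).getD i false = p i := by
  simp [initial, List.getD_eq_getElem?_getD, h]

theorem initial_congr {p q : Cantor} {m : ℕ} (h : ∀ i < m, p i = q i) :
    p.initial m = q.initial m := by
  simpa [initial] using h

theorem eq_of_initial {p q : Cantor} {m : ℕ} (h : p.initial m = q.initial m) {i : ℕ} (hi : i < m) :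
    p i = q i := by
  rw [← getD_initial p hi, h, getD_initial q hi]

theorem isOpen_agree (p : Cantor) (m : ℕ) : IsOpen {q : Cantor | ∀ i < m, q i = p i} := by
  have : {q : Cantor | ∀ i < m, q i = p i} = ⋂ i ∈ Set.Iio m, {q : Cantor | q i = p i} := by
    ext q; simp
  rw [this]
  exact (Set.finite_Iio m).isOpen_biInter fun i _ =>
    (isOpen_discrete ({p i} : Set Bool)).preimage (continuous_apply (A := fun _ : ℕ => Bool) i)

theorem exists_agree_subset {W : Set Cantor} (hW : IsOpen W) {p : Cantor} (hp : p ∈ W) :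
    ∃ m, ∀ q : Cantor, (∀ i < m, q i = p i) → q ∈ W := by
  obtain ⟨_, ⟨x, n, rfl⟩, hx, hsub⟩ :=
    (PiNat.isTopologicalBasis_cylinders (fun _ : ℕ => Bool)).exists_subset_of_mem_open hp hW
  exact ⟨n, fun q hq => hsub fun i hi => (hq i hi).trans (hx i hi)⟩

end Cantor

/-- What a machine writes depends on a finite part of its input only. -/
theorem MachineWrites.exists_prefix {c : Nat.Partrec.Code} {p : Cantor} {k : ℕ} {b : Bool}
    (h : MachineWrites c p k b) :
    ∃ m, ∀ q : Cantor, (∀ i < m, q i = p i) → MachineWrites c q k b := by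
  obtain ⟨m, h1, h2⟩ := h
  refine ⟨m, fun q hq => ⟨m, fun j hj => ?_, ?_⟩⟩
  · rw [Cantor.initial_congr fun i hi => hq i (hi.trans hj)]
    exact h1 j hj
  · rw [Cantor.initial_congr hq]
    exact h2

/-- The finite word with number `k`. -/
def word (k : ℕ) : List Bool := (Encodable.decode k : Option (List Bool)).getD []

theorem word_encode (w : List Bool) : word (Encodable.encode w) = w := by
  simp [word]

/-- The program of a machine that, on the tape `⟨p, q⟩`, writes `true` into cell `k` iff
`p k = true` and `q` begins with the word with number `k`. -/
def searchAnswer (a : List Bool × ℕ) : Option Bool :=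
  if a.1.length < 2 * (a.2 + (word a.2).length + 1) then none
  else some (a.1.getD (2 * a.2) false &&
    decide ((List.range (word a.2).length).map (fun i => a.1.getD (2 * i + 1) false) = word a.2))

theorem primrec_searchAnswer : Primrec searchAnswer := by
  have hw : Primrec fun a : List Bool × ℕ => word a.2 :=
    Primrec.option_getD.comp (Primrec.decode.comp Primrec.snd) (Primrec.const [])
  have hl : Primrec fun a : List Bool × ℕ => (word a.2).length := Primrec.list_length.comp hw
  have hN : Primrec fun a : List Bool × ℕ => 2 * (a.2 + (word a.2).length + 1) :=
    Primrec.nat_mul.comp (Primrec.const 2)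
      (Primrec.succ.comp (Primrec.nat_add.comp Primrec.snd hl))
  have hm : Primrec fun a : List Bool × ℕ =>
      (List.range (word a.2).length).map (fun i => a.1.getD (2 * i + 1) false) := by
    refine Primrec.list_map (Primrec.list_range.comp hl) ?_
    exact (Primrec.list_getD false).comp (Primrec.fst.comp Primrec.fst)
      (Primrec.succ.comp (Primrec.nat_mul.comp (Primrec.const 2) Primrec.snd))
  refine Primrec.ite (Primrec.nat_lt.comp (Primrec.list_length.comp Primrec.fst) hN)
    (Primrec.const none) (Primrec.option_some.comp (Primrec.and.comp ?_ ?_))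
  · exact (Primrec.list_getD false).comp Primrec.fst
      (Primrec.nat_mul.comp (Primrec.const 2) Primrec.snd)
  · exact PrimrecPred.decide (Primrec.eq.comp hm hw)

theorem exists_search_machine : ∃ n : ℕ, ∀ (p q : Cantor) (k : ℕ),
    MachineWrites (Denumerable.ofNat Nat.Partrec.Code n) (p.pair q) k
      (p k && decide (q.initial (word k).length = word k)) := by
  obtain ⟨c, hc⟩ := Nat.Partrec.Code.exists_code.1 primrec_searchAnswer.to_comp.partrec
  have hev : ∀ σ k, Encodable.encode (searchAnswer (σ, k)) ∈ c.eval (Encodable.encode (σ, k)) := by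
    intro σ k
    rw [hc]
    simp
  refine ⟨Encodable.encode c, fun p q k => ?_⟩
  rw [Denumerable.ofNat_encode]
  refine ⟨2 * (k + (word k).length + 1), fun j hj => ?_, ?_⟩
  · have := hev ((p.pair q).initial j) k
    rwa [searchAnswer, if_pos (by simpa [Cantor.length_initial] using hj)] at this
  · have := hev ((p.pair q).initial (2 * (k + (word k).length + 1))) k
    rw [searchAnswer, if_neg (by simp [Cantor.length_initial])] at this
    have h1 : ((p.pair q).initial (2 * (k + (word k).length + 1))).getD (2 * k) false = p k := by
      rw [Cantor.getD_initial _ (by omega)]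
      simp [Cantor.pair]
    have h2 : (List.range (word k).length).map (fun i =>
        ((p.pair q).initial (2 * (k + (word k).length + 1))).getD (2 * i + 1) false) =
        q.initial (word k).length := by
      refine List.map_congr_left fun i hi => ?_
      rw [List.mem_range] at hi
      rw [Cantor.getD_initial _ (by omega)]
      simp [Cantor.pair, show (2 * i + 1) / 2 = i by omega]
    simp only [h1, h2] at this
    exact this

namespace RepSpace

/-- Every set that is open in the quotient topology is an element of `𝒪(X)`. -/
theorem exists_name_of_isOpen (X : RepSpace.{u}) {U : Set X} (hU : @IsOpen _ X.topology U) :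
    ∃ r, IsFunName X sierpinski r (X.char U) := by
  classical
  obtain ⟨n, hn⟩ := exists_search_machine
  obtain ⟨W, hW, hWU⟩ := isOpen_induced_iff.1 (isOpen_coinduced.1 hU)
  have hmem : ∀ {q x}, X.IsName q x → (q ∈ W ↔ x ∈ U) := by
    intro q x h
    have : (⟨q, x, h⟩ : {p : Cantor // ∃ x, X.IsName p x}) ∈ Subtype.val ⁻¹' W ↔
        (⟨q, x, h⟩ : {p : Cantor // ∃ x, X.IsName p x}) ∈ X.delta ⁻¹' U := by rw [hWU]
    simpa [X.delta_eq h] using this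
  let p : Cantor := fun k =>
    decide (∀ q : Cantor, q.initial (word k).length = word k → q ∈ W)
  refine ⟨_, n, p, rfl, fun q x s hq hs => ?_⟩
  refine ⟨_, mem_machineMap.2 (hn p q), ?_⟩
  obtain rfl := Part.mem_some_iff.1 hs
  change x ∈ U ↔ _
  rw [← hmem hq]
  simp only [Bool.and_eq_true, decide_eq_true_eq, p]
  constructor
  · intro hqW
    obtain ⟨m, hm⟩ := Cantor.exists_agree_subset hW hqW
    refine ⟨Encodable.encode (q.initial m), ?_, ?_⟩
    · intro q' hq'
      rw [word_encode, Cantor.length_initial] at hq'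
      exact hm q' fun i hi => Cantor.eq_of_initial hq' hi
    · rw [word_encode, Cantor.length_initial]
  · rintro ⟨k, h1, h2⟩
    exact h1 q h2

/-- The set `{U ∈ 𝒪(X) | U ∩ A ≠ ∅}`. -/
def meeting (X : RepSpace.{u}) (A : Set X) : Set X.opens := {U | (U.1 ∩ A).Nonempty}

theorem isOpen_meeting (X : RepSpace.{u}) (A : Set X) :
    @IsOpen _ X.opens.topology (X.meeting A) := by
  refine isOpen_coinduced.2 (isOpen_iff_forall_mem_open.2 ?_)
  rintro ⟨r, U, hU⟩ hr
  rw [Set.mem_preimage, X.opens.delta_eq hU] at hr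
  obtain ⟨x, hxU, hxA⟩ := hr
  obtain ⟨n, p, rfl, hp⟩ := id hU
  obtain ⟨q, hq⟩ := X.surj x
  obtain ⟨s, hs, hs'⟩ := hp q x _ hq (Part.mem_some _)
  obtain ⟨k, hk⟩ := hs'.1 hxU
  obtain ⟨m, hm⟩ := (mem_machineMap.1 hs k).exists_prefix
  refine ⟨Subtype.val ⁻¹' {r' : Cantor | ∀ i < n + 1 + m, r' i = Cantor.prepend n p i}, ?_,
    (Cantor.isOpen_agree _ _).preimage continuous_subtype_val, fun i _ => rfl⟩
  rintro ⟨r', U', hU'⟩ hr'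
  rw [Set.mem_preimage, X.opens.delta_eq hU']
  refine ⟨x, ?_, hxA⟩
  obtain ⟨n', p', rfl, hp'⟩ := id hU'
  have hr'' : ∀ i < n + 1 + m, Cantor.prepend n' p' i = Cantor.prepend n p i := hr'
  have hn : n' = n := by
    rcases lt_trichotomy n' n with h | h | h
    · have := hr'' n' (by omega)
      simp [Cantor.prepend, h] at this
    · exact h
    · have := hr'' n (by omega)
      simp [Cantor.prepend, h] at this
  subst hn
  have hpp : ∀ i < m, p' i = p i := by
    intro i hi
    have := hr'' (n' + 1 + i) (by omega)
    simpa [Cantor.prepend, show ¬ (n' + 1 + i < n') by omega,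
      show ¬ (n' + 1 + i = n') by omega] using this
  obtain ⟨s', ht, ht'⟩ := hp' q x _ hq (Part.mem_some _)
  refine ht'.2 ⟨k, ?_⟩
  rw [← hk]
  refine (mem_machineMap.1 ht k).unique (hm _ fun i hi => ?_)
  simp only [Cantor.pair]
  split
  · exact hpp _ (by omega)
  · rfl

/-- The space `𝒱(X)` of overt sets: the closed sets, where `A` is identified with the element
`{U ∈ 𝒪(X) | U ∩ A ≠ ∅}` of `𝒪(𝒪(X))`. -/
def overts (X : RepSpace.{u}) : RepSpace.{u} where
  carrier := {A : Set X // @IsClosed _ X.topology A}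
  IsName r A := IsFunName X.opens sierpinski r (X.opens.char (X.meeting A.1))
  unique := by
    have key : ∀ {A B : {A : Set X // @IsClosed _ X.topology A}} {r : Cantor},
        IsFunName X.opens sierpinski r (X.opens.char (X.meeting A.1)) →
        IsFunName X.opens sierpinski r (X.opens.char (X.meeting B.1)) → A.1 ⊆ B.1 := by
      intro A B r hA hB x hx
      by_contra hxB
      let U : X.opens := ⟨B.1ᶜ, X.exists_name_of_isOpen (@IsClosed.isOpen_compl _ X.topology _ B.2)⟩
      have : U ∈ X.meeting A.1 ↔ U ∈ X.meeting B.1 := iff_of_eq (congrFun (hA.unique hB) U)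
      obtain ⟨y, hy, hy'⟩ := this.1 ⟨x, hxB, hx⟩
      exact hy hy'
    exact fun {_ _ _} hA hB => Subtype.ext ((key hA hB).antisymm (key hB hA))
  surj A := X.opens.exists_name_of_isOpen (X.isOpen_meeting A.1)

/-- The closure of a subset in the quotient topology, as an element of `𝒱(X)`. -/
def cl (X : RepSpace.{u}) (A : Set X) : X.overts :=
  ⟨@closure X X.topology A, @isClosed_closure X X.topology A⟩

/-- The union of two closed sets, as an element of `𝒱(X)`. -/
def union (X : RepSpace.{u}) (A B : X.overts) : X.overts :=
  ⟨A.1 ∪ B.1, @IsClosed.union X A.1 B.1 X.topology A.2 B.2⟩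

/-- `X` is computably overt: the map `𝒪(X) → 𝕊` that takes the value `⊤` exactly on the non-empty
open sets is computable. -/
def ComputablyOvert (X : RepSpace.{u}) : Prop :=
  IsComputable X.opens sierpinski fun U => (U.1.Nonempty : Prop)

end RepSpace

/-! ### Prefixes of sequences and bounded quantifiers -/

open Filter

/-! A name of `A ∈ 𝒱(X)` is a name of the function on `𝒪(X)` that recognizes the open sets meeting
`A`. By currying, a map into `𝒱(X)` is computable as soon as "`U` meets the value at `x`" is
semidecidable in `(x, U)` (`isComputablePartial_overts`). Closures cost nothing, since an open set
meets the closure of `S` iff it meets `S` (`nonempty_inter_cl`).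

Each item then rests on an elementary equivalence. For example, `U` meets `A ∩ V` iff `V ∩ U` meets
`A`; `U` meets `π₁[A]` iff `U × Y` meets `A`; `U` meets `f[A]` iff `f⁻¹(U)` meets `A`; and `U` meets
`f⁻¹(A)` iff `f[U] = F(U)` meets `A`. The last condition mentions only `F`, and closed sets are
determined by the open sets they meet, so the closure of `f⁻¹(A)` does not depend on `f`.

The right-hand sides are semidecidable because computable maps are closed under composition and
pairing and include the projections, evaluation (`exists_evaluation_program`), and conjunction and
disjunction on `𝕊`; an existential quantifier over `ℕ` preserves semidecidability
(`IsComputable.exists_nat`). To prove this, partial recursive machines are traded for primitive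
recursive programs acting on finite prefixes of the input (`isComputablePartial_iff`); a
step-bounded universal machine makes this possible. -/

theorem Cantor.take_initial (p : Cantor) {j m : ℕ} (h : j ≤ m) :
    (p.initial m).take j = p.initial j := by
  simp [Cantor.initial, ← List.map_take, List.take_range, h]

theorem Cantor.getElem?_initial (p : Cantor) (m i : ℕ) :
    (p.initial m)[i]? = if i < m then some (p i) else none := by
  split_ifs with h <;> simp [Cantor.initial, h]

theorem Cantor.pair_even (p q : Cantor) (k : ℕ) : p.pair q (2 * k) = p k := by
  simp [Cantor.pair]

theorem Cantor.pair_odd (p q : Cantor) (k : ℕ) : p.pair q (2 * k + 1) = q k := by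
  simp [Cantor.pair, show (2 * k + 1) / 2 = k by omega]

theorem primrecPred_forall_lt {α : Type*} [Primcodable α] {R : ℕ → α → Prop} (hR : PrimrecRel R)
    {N : α → ℕ} (hN : Primrec N) : PrimrecPred fun a => ∀ i < N a, R i a :=
  ((PrimrecRel.forall_mem_list hR).comp (Primrec.list_range.comp hN) Primrec.id).of_eq
    fun a => by simp

theorem primrecPred_exists_lt {α : Type*} [Primcodable α] {R : ℕ → α → Prop} (hR : PrimrecRel R)
    {N : α → ℕ} (hN : Primrec N) : PrimrecPred fun a => ∃ i < N a, R i a :=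
  ((PrimrecRel.exists_mem_list hR).comp (Primrec.list_range.comp hN) Primrec.id).of_eq
    fun a => by simp

/-! ### Approximation by total programs -/

/-- The program `g`, which maps a prefix of the input and a cell number to the bit in this cell or
to `none` if the prefix is too short, produces the output `s` on input `p`. -/
structure Approximates (g : List Bool × ℕ → Option Bool) (p s : Cantor) : Prop where
  sound : ∀ {m k b}, g (p.initial m, k) = some b → s k = b
  complete : ∀ k, ∀ᶠ m in atTop, (g (p.initial m, k)).isSome

/-- The longest prefix of the output that `g` determines from the prefix `w` of the input, up to
the length of `w`. -/
def outputPrefix (g : List Bool × ℕ → Option Bool) (w : List Bool) : List Bool :=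
  (List.range (Nat.findGreatest (fun l => ∀ k < l, (g (w, k)).isSome) w.length)).map
    fun k => (g (w, k)).getD false

theorem primrec_outputPrefix {g : List Bool × ℕ → Option Bool} (hg : Primrec g) :
    Primrec (outputPrefix g) := by
  have h1 : PrimrecRel fun (k : ℕ) (a : List Bool × ℕ) => (g (a.1, k)).isSome = true :=
    Primrec.eq.comp (Primrec.option_isSome.comp
      (hg.comp ((Primrec.fst.comp Primrec.snd).pair Primrec.fst))) (Primrec.const true)
  have h2 : PrimrecRel fun (w : List Bool) (l : ℕ) => ∀ k < l, (g (w, k)).isSome = true :=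
    primrecPred_forall_lt h1 Primrec.snd
  exact Primrec.list_map
    (Primrec.list_range.comp (Primrec.nat_findGreatest Primrec.list_length h2))
    (Primrec.option_getD.comp hg (Primrec.const false))

namespace Approximates

variable {g : List Bool × ℕ → Option Bool} {p s : Cantor}

theorem outputPrefix_initial (h : Approximates g p s) (m : ℕ) :
    ∃ l, outputPrefix g (p.initial m) = s.initial l := by
  refine ⟨_, List.map_congr_left fun k hk => ?_⟩
  -- The bound `l = 0` satisfies the condition vacuously, so the greatest one does too.
  have hs := Nat.findGreatest_spec (P := fun l => ∀ k < l, (g (p.initial m, k)).isSome)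
    (Nat.zero_le (p.initial m).length) (by simp) k (List.mem_range.1 hk)
  obtain ⟨b, hb⟩ := Option.isSome_iff_exists.1 hs
  rw [hb, Option.getD_some, h.sound hb]

theorem eventually_le_length (h : Approximates g p s) (l : ℕ) :
    ∀ᶠ m in atTop, l ≤ (outputPrefix g (p.initial m)).length := by
  -- Eventually the first `l` cells are all determined; `m ≥ l` is also needed, as the output is cut
  -- at the length of the input.
  have h1 : ∀ᶠ m in atTop, ∀ k ∈ Finset.range l, (g (p.initial m, k)).isSome :=
    (Filter.eventually_all_finset _).2 fun k _ => h.complete k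
  filter_upwards [h1, eventually_ge_atTop l] with m hm hl
  simp only [outputPrefix, List.length_map, List.length_range]
  exact Nat.le_findGreatest (by simpa [Cantor.length_initial] using hl)
    fun k hk => hm k (Finset.mem_range.2 hk)

/-- The output lengths tend to infinity with the input lengths. -/
theorem exists_tendsto (h : Approximates g p s) : ∃ l : ℕ → ℕ, Tendsto l atTop atTop ∧
    ∀ m, outputPrefix g (p.initial m) = s.initial (l m) := by
  choose l hl using h.outputPrefix_initial
  refine ⟨l, tendsto_atTop.2 fun k => ?_, hl⟩
  filter_upwards [h.eventually_le_length k] with m hm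
  rwa [hl, Cantor.length_initial] at hm

/-- The known prefix of the intermediate sequence grows without bound, so whatever holds eventually
along its prefixes holds eventually along those of `p`. -/
theorem comp {g' : List Bool × ℕ → Option Bool} {t : Cantor} (h' : Approximates g' s t)
    (h : Approximates g p s) : Approximates (fun a => g' (outputPrefix g a.1, a.2)) p t := by
  obtain ⟨l, hl, hl'⟩ := h.exists_tendsto
  constructor
  · intro m k b hb
    simp only [hl'] at hb
    exact h'.sound hb
  · intro k
    simp only [hl']
    exact hl.eventually (h'.complete k)

/-- A program that looks at the first `N k` symbols of the input in order to determine cell `k`. -/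
theorem of_modulus {N : ℕ → ℕ} {G : List Bool × ℕ → Bool}
    (h : ∀ m k, N k ≤ m → G (p.initial m, k) = s k) :
    Approximates (fun a => if a.1.length < N a.2 then none else some (G a)) p s := by
  constructor
  · intro m k b hb
    simp only [Cantor.length_initial] at hb
    split_ifs at hb with hN
    rw [← h m k (not_lt.1 hN)]
    exact Option.some.inj hb
  · intro k
    filter_upwards [eventually_ge_atTop (N k)] with m hm
    simp [Cantor.length_initial, hm]

theorem pair {g' : List Bool × ℕ → Option Bool} {s' : Cantor} (h : Approximates g p s)
    (h' : Approximates g' p s') :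
    Approximates (fun a => if a.2 % 2 = 0 then g (a.1, a.2 / 2) else g' (a.1, a.2 / 2)) p
      (s.pair s') := by
  constructor
  · intro m k b hb
    simp only [Cantor.pair]
    split_ifs at hb ⊢
    · exact h.sound hb
    · exact h'.sound hb
  · intro k
    dsimp only
    split_ifs
    · exact h.complete _
    · exact h'.complete _

end Approximates

theorem primrec_modulus {N : ℕ → ℕ} {G : List Bool × ℕ → Bool} (hN : Primrec N) (hG : Primrec G) :
    Primrec fun a : List Bool × ℕ => if a.1.length < N a.2 then none else some (G a) :=
  Primrec.ite (Primrec.nat_lt.comp (Primrec.list_length.comp Primrec.fst) (hN.comp Primrec.snd))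
    (Primrec.const none) (Primrec.option_some.comp hG)

/-! ### Programs for machines -/

/-- Every total program is the program of a machine. -/
theorem exists_code_of_primrec {g : List Bool × ℕ → Option Bool} (hg : Primrec g) :
    ∃ c : Nat.Partrec.Code, ∀ p s, Approximates g p s → s ∈ machineMap c p := by
  obtain ⟨c, hc⟩ := Nat.Partrec.Code.exists_code.1 hg.to_comp.partrec
  have hev : ∀ σ k, Encodable.encode (g (σ, k)) ∈ c.eval (Encodable.encode (σ, k)) := by
    intro σ k
    rw [hc]
    simp
  refine ⟨c, fun p s h => mem_machineMap.2 fun k => ?_⟩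
  have hex := (h.complete k).exists
  classical
  -- The machine stops at the first prefix on which `g` answers; every earlier `none` tells it to
  -- read on.
  refine ⟨Nat.find hex, fun j hj => ?_, ?_⟩
  · have := hev (p.initial j) k
    rwa [Option.not_isSome_iff_eq_none.1 (Nat.find_min hex hj)] at this
  · have := hev (p.initial (Nat.find hex)) k
    obtain ⟨b, hb⟩ := Option.isSome_iff_exists.1 (Nat.find_spec hex)
    rwa [hb, ← h.sound hb] at this

/-- Simulation of `MachineWrites` on the word `a.1.2`, whose length bounds the running times;
the answer is given after reading `m` symbols. -/
def WordWritesAt (b : Bool) (m : ℕ) (a : (Nat.Partrec.Code × List Bool) × ℕ) : Prop :=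
  (∀ j < m, Nat.Partrec.Code.evaln a.1.2.length a.1.1
    (Encodable.encode (a.1.2.take j, a.2)) = some (Encodable.encode (none : Option Bool))) ∧
  Nat.Partrec.Code.evaln a.1.2.length a.1.1
    (Encodable.encode (a.1.2.take m, a.2)) = some (Encodable.encode (some b))

/-- The machine `a.1.1` is seen to write `b` into cell `a.2` when it is simulated on the word
`a.1.2`. -/
def WordWrites (b : Bool) (a : (Nat.Partrec.Code × List Bool) × ℕ) : Prop :=
  ∃ m < a.1.2.length + 1, WordWritesAt b m a

theorem primrec_evaln_take :
    Primrec fun a : ℕ × ((Nat.Partrec.Code × List Bool) × ℕ) =>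
      Nat.Partrec.Code.evaln a.2.1.2.length a.2.1.1
        (Encodable.encode (a.2.1.2.take a.1, a.2.2)) := by
  have hw : Primrec fun a : ℕ × ((Nat.Partrec.Code × List Bool) × ℕ) => a.2.1.2 :=
    Primrec.snd.comp (Primrec.fst.comp Primrec.snd)
  exact Nat.Partrec.Code.primrec_evaln.comp
    (((Primrec.list_length.comp hw).pair (Primrec.fst.comp (Primrec.fst.comp Primrec.snd))).pair
      (Primrec.encode.comp ((Primrec.list_take.comp Primrec.fst hw).pair
        (Primrec.snd.comp Primrec.snd))))

theorem primrecPred_wordWrites (b : Bool) : PrimrecPred (WordWrites b) := by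
  have h1 : PrimrecRel fun (i : ℕ) (a : ℕ × (Nat.Partrec.Code × List Bool) × ℕ) =>
      Nat.Partrec.Code.evaln a.2.1.2.length a.2.1.1
        (Encodable.encode (a.2.1.2.take i, a.2.2)) = some (Encodable.encode (none : Option Bool)) :=
    Primrec.eq.comp (primrec_evaln_take.comp (Primrec.fst.pair (Primrec.snd.comp Primrec.snd)))
      (Primrec.const _)
  have h2 : PrimrecPred fun a : ℕ × (Nat.Partrec.Code × List Bool) × ℕ =>
      Nat.Partrec.Code.evaln a.2.1.2.length a.2.1.1
        (Encodable.encode (a.2.1.2.take a.1, a.2.2)) = some (Encodable.encode (some b)) :=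
    Primrec.eq.comp primrec_evaln_take (Primrec.const _)
  have h3 : PrimrecRel (WordWritesAt b) := (primrecPred_forall_lt h1 Primrec.fst).and h2
  exact primrecPred_exists_lt h3
    (Primrec.succ.comp (Primrec.list_length.comp (Primrec.snd.comp Primrec.fst)))

theorem WordWrites.sound {c : Nat.Partrec.Code} {p : Cantor} {m k : ℕ} {b : Bool}
    (h : WordWrites b ((c, p.initial m), k)) : MachineWrites c p k b := by
  obtain ⟨i, hi, h1, h2⟩ := h
  simp only [Cantor.length_initial] at hi h1 h2
  refine ⟨i, fun j hj => ?_, ?_⟩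
  · have := h1 j hj
    rw [Cantor.take_initial p (by omega)] at this
    exact Nat.Partrec.Code.evaln_sound this
  · rw [Cantor.take_initial p (by omega)] at h2
    exact Nat.Partrec.Code.evaln_sound h2

/-- Only finitely many halting computations are involved, and `evaln` is monotone in its bound, so
one long enough word witnesses all of them. -/
theorem MachineWrites.eventually_wordWrites {c : Nat.Partrec.Code} {p : Cantor} {k : ℕ} {b : Bool}
    (h : MachineWrites c p k b) : ∀ᶠ m in atTop, WordWrites b ((c, p.initial m), k) := by
  have key : ∀ {x y}, x ∈ c.eval y → ∀ᶠ m in atTop, x ∈ c.evaln m y := by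
    intro x y hx
    obtain ⟨n, hn⟩ := Nat.Partrec.Code.evaln_complete.1 hx
    filter_upwards [eventually_ge_atTop n] with m hm using Nat.Partrec.Code.evaln_mono hm hn
  obtain ⟨i, h1, h2⟩ := h
  have h1' := (Filter.eventually_all_finset (Finset.range i)).2
    fun j hj => key (h1 j (Finset.mem_range.1 hj))
  filter_upwards [h1', key h2, eventually_ge_atTop i] with m hm1 hm2 hm
  refine ⟨i, by simpa [Cantor.length_initial] using Nat.lt_succ_of_le hm, fun j hj => ?_, ?_⟩
  · simp only [Cantor.length_initial]
    rw [Cantor.take_initial p (by omega)]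
    exact hm1 j (Finset.mem_range.2 hj)
  · simp only [Cantor.length_initial]
    rw [Cantor.take_initial p hm]
    exact hm2

theorem Cantor.initial_prepend (n : ℕ) (p : Cantor) (m : ℕ) :
    (prepend n p).initial (n + 1 + m) = List.replicate n false ++ true :: p.initial m := by
  apply List.ext_getElem?
  intro i
  rw [getElem?_initial, List.getElem?_append]
  simp only [List.length_replicate, prepend]
  rcases lt_trichotomy i n with h | rfl | h
  · simp [h, show i < n + 1 + m by omega]
  · simp; omega
  · obtain ⟨j, rfl⟩ : ∃ j, i = n + 1 + j := ⟨i - (n + 1), by omega⟩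
    simp only [show ¬ n + 1 + j < n by omega, if_false, show n + 1 + j - n = j + 1 by omega,
      List.getElem?_cons_succ, getElem?_initial]
    simp [show ¬ (n + 1 + j = n) by omega]

theorem drop_replicate_append (n : ℕ) (b c : Bool) (w : List Bool) :
    (List.replicate n b ++ c :: w).drop (n + 1) = w := by
  simp [List.drop_append]

theorem Cantor.idxOf_initial_prepend (n : ℕ) (p : Cantor) (m : ℕ) :
    ((prepend n p).initial (n + 1 + m)).idxOf true = n := by
  rw [initial_prepend, List.idxOf_append]
  simp

theorem Cantor.idxOf_initial_prepend_of_le {n m : ℕ} (p : Cantor) (h : m ≤ n) :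
    ((prepend n p).initial m).idxOf true = m := by
  conv_rhs => rw [← length_initial (prepend n p) m]
  refine List.idxOf_eq_length ?_
  simp only [initial, prepend, List.mem_map, List.mem_range, not_exists, not_and]
  intro i hi
  simp [show i < n by omega]

open Classical in
/-- A program that simulates, on the tape `0^n 1 t`, the machine with number `n` on the tape `t`. -/
noncomputable def universalProgram (a : List Bool × ℕ) : Option Bool :=
  -- `idxOf` returns the length when there is no `true`, so this tests whether `0^n 1` has been read
  -- completely.
  if a.1.idxOf true < a.1.length then
    if WordWrites true ((Denumerable.ofNat Nat.Partrec.Code (a.1.idxOf true),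
      a.1.drop (a.1.idxOf true + 1)), a.2) then some true
    else if WordWrites false ((Denumerable.ofNat Nat.Partrec.Code (a.1.idxOf true),
      a.1.drop (a.1.idxOf true + 1)), a.2) then some false
    else none
  else none

theorem primrec_universalProgram : Primrec universalProgram := by
  classical
  have hi : Primrec fun a : List Bool × ℕ => a.1.idxOf true :=
    Primrec.list_idxOf.comp (Primrec.const true) Primrec.fst
  have hc : Primrec fun a : List Bool × ℕ =>
      ((Denumerable.ofNat Nat.Partrec.Code (a.1.idxOf true), a.1.drop (a.1.idxOf true + 1)),
        a.2) :=
    (((Primrec.ofNat _).comp hi).pair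
      (Primrec.list_drop.comp (Primrec.succ.comp hi) Primrec.fst)).pair Primrec.snd
  exact Primrec.ite (Primrec.nat_lt.comp hi (Primrec.list_length.comp Primrec.fst))
    (Primrec.ite ((primrecPred_wordWrites true).comp hc) (Primrec.const _)
      (Primrec.ite ((primrecPred_wordWrites false).comp hc) (Primrec.const _) (Primrec.const _)))
    (Primrec.const _)

open Classical in
theorem universalProgram_initial (n : ℕ) (t : Cantor) (m k : ℕ) :
    universalProgram ((Cantor.prepend n t).initial (n + 1 + m), k) =
      if WordWrites true ((Denumerable.ofNat Nat.Partrec.Code n, t.initial m), k) then some true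
      else if WordWrites false ((Denumerable.ofNat Nat.Partrec.Code n, t.initial m), k) then
        some false
      else none := by
  have hd : ((Cantor.prepend n t).initial (n + 1 + m)).drop (n + 1) = t.initial m := by
    rw [Cantor.initial_prepend, drop_replicate_append]
  rw [universalProgram, if_pos]
  · simp only [Cantor.idxOf_initial_prepend, hd]
  · simp only [Cantor.idxOf_initial_prepend, Cantor.length_initial]
    omega

/-- A machine writes at most one bit into a cell, so the order of the two tests is immaterial, and
once the simulation is long enough one of them succeeds forever. -/
theorem approximates_universalProgram {n : ℕ} {t s : Cantor}
    (h : s ∈ machineMap (Denumerable.ofNat Nat.Partrec.Code n) t) :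
    Approximates universalProgram (Cantor.prepend n t) s := by
  rw [mem_machineMap] at h
  constructor
  · intro m k b hb
    rcases le_or_gt m n with hm | hm
    · simp [universalProgram, Cantor.idxOf_initial_prepend_of_le t hm, Cantor.length_initial] at hb
    · obtain ⟨m, rfl⟩ : ∃ m', m = n + 1 + m' := ⟨m - (n + 1), by omega⟩
      rw [universalProgram_initial] at hb
      split_ifs at hb with h1 h2
      · exact Option.some.inj hb ▸ (h k).unique h1.sound
      · exact Option.some.inj hb ▸ (h k).unique h2.sound
  · intro k
    obtain ⟨N, hN⟩ := eventually_atTop.1 (h k).eventually_wordWrites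
    filter_upwards [eventually_ge_atTop (n + 1 + N)] with m hm
    obtain ⟨m, rfl⟩ : ∃ m', m = n + 1 + m' := ⟨m - (n + 1), by omega⟩
    have hm := hN m (by omega)
    rw [universalProgram_initial]
    split_ifs with h1 h2
    · rfl
    · rfl
    · cases hs : s k <;> rw [hs] at hm <;> contradiction

/-- A program for the map `p ↦ 0^n 1 p`. -/
def prependProgram (n : ℕ) (a : List Bool × ℕ) : Option Bool :=
  if a.1.length < a.2 then none
  else some (if a.2 < n then false else if a.2 = n then true else a.1.getD (a.2 - (n + 1)) false)

theorem primrec_prependProgram (n : ℕ) : Primrec (prependProgram n) :=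
  primrec_modulus (N := fun k => k) Primrec.id
    (Primrec.ite (Primrec.nat_lt.comp Primrec.snd (Primrec.const n)) (Primrec.const _)
      (Primrec.ite (Primrec.eq.comp Primrec.snd (Primrec.const n)) (Primrec.const _)
        ((Primrec.list_getD false).comp Primrec.fst
          (Primrec.nat_sub.comp Primrec.snd (Primrec.const (n + 1))))))

theorem approximates_prependProgram (n : ℕ) (p : Cantor) :
    Approximates (prependProgram n) p (Cantor.prepend n p) := by
  refine Approximates.of_modulus (N := fun k => k) (G := fun a => if a.2 < n then false
    else if a.2 = n then true else a.1.getD (a.2 - (n + 1)) false) fun m k hk => ?_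
  simp only [Cantor.prepend]
  split_ifs with h1 h2
  · rfl
  · rfl
  · rw [Cantor.getD_initial _ (by omega)]

/-- Prepend the number of the machine to the tape and run the universal program. -/
theorem exists_primrec_of_code (c : Nat.Partrec.Code) :
    ∃ g, Primrec g ∧ ∀ p s, s ∈ machineMap c p → Approximates g p s := by
  refine ⟨_, primrec_universalProgram.comp (((primrec_outputPrefix
    (primrec_prependProgram (Encodable.encode c))).comp Primrec.fst).pair Primrec.snd),
    fun p s h => ?_⟩
  refine (approximates_universalProgram (n := Encodable.encode c) ?_).comp
    (approximates_prependProgram _ p)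
  rwa [Denumerable.ofNat_encode]

/-! ### Computable maps via total programs, composition and pairing -/

namespace RepSpace

variable {W : RepSpace.{u}} {X : RepSpace.{v}} {Y : RepSpace.{w}}

/-- Lets realizers be built from primitive recursive functions on words, without handling
divergence. -/
theorem isComputablePartial_iff {f : X →. Y} : IsComputablePartial X Y f ↔
    ∃ g, Primrec g ∧ ∀ p x y, X.IsName p x → y ∈ f x → ∃ s, Approximates g p s ∧ Y.IsName s y := by
  constructor
  · rintro ⟨c, hc⟩
    obtain ⟨g, hg, h⟩ := exists_primrec_of_code c
    refine ⟨g, hg, fun p x y hp hy => ?_⟩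
    obtain ⟨s, hs, hs'⟩ := hc p x y hp hy
    exact ⟨s, h p s hs, hs'⟩
  · rintro ⟨g, hg, h⟩
    obtain ⟨c, hc⟩ := exists_code_of_primrec hg
    refine ⟨c, fun p x y hp hy => ?_⟩
    obtain ⟨s, hs, hs'⟩ := h p x y hp hy
    exact ⟨s, hc p s hs, hs'⟩

theorem isComputable_iff {f : X → Y} : IsComputable X Y f ↔
    ∃ g, Primrec g ∧ ∀ p x, X.IsName p x → ∃ s, Approximates g p s ∧ Y.IsName s (f x) := by
  refine isComputablePartial_iff.trans (exists_congr fun g => and_congr_right fun _ => ?_)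
  constructor
  · exact fun h p x hp => h p x (f x) hp (Part.mem_some _)
  · intro h p x y hp hy
    obtain rfl := Part.mem_some_iff.1 hy
    exact h p x hp

/-- A map that is realized by a function whose cell `k` depends on the first `N k` symbols. -/
theorem isComputable_of_modulus {f : X → Y} {N : ℕ → ℕ} {G : List Bool × ℕ → Bool}
    (hN : Primrec N) (hG : Primrec G)
    (h : ∀ p x, X.IsName p x → ∃ s, Y.IsName s (f x) ∧ ∀ m k, N k ≤ m → G (p.initial m, k) = s k) :
    IsComputable X Y f := by
  refine isComputable_iff.2 ⟨_, primrec_modulus hN hG, fun p x hp => ?_⟩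
  obtain ⟨s, hs, hs'⟩ := h p x hp
  exact ⟨s, Approximates.of_modulus hs', hs⟩

theorem IsComputable.comp {f : X → Y} {g : W → X} (hf : IsComputable X Y f)
    (hg : IsComputable W X g) : IsComputable W Y (fun x => f (g x)) := by
  obtain ⟨a, ha, ha'⟩ := isComputable_iff.1 hf
  obtain ⟨b, hb, hb'⟩ := isComputable_iff.1 hg
  refine isComputable_iff.2 ⟨_, ha.comp (((primrec_outputPrefix hb).comp Primrec.fst).pair
    Primrec.snd), fun p x hp => ?_⟩
  obtain ⟨s, hs, hs'⟩ := hb' p x hp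
  obtain ⟨t, ht, ht'⟩ := ha' s _ hs'
  exact ⟨t, ht.comp hs, ht'⟩

theorem IsComputable.pair {f : W → X} {g : W → Y} (hf : IsComputable W X f)
    (hg : IsComputable W Y g) : IsComputable W (X.prod Y) (fun x => (f x, g x)) := by
  obtain ⟨a, ha, ha'⟩ := isComputable_iff.1 hf
  obtain ⟨b, hb, hb'⟩ := isComputable_iff.1 hg
  have hdiv : Primrec fun a : List Bool × ℕ => (a.1, a.2 / 2) :=
    Primrec.fst.pair (Primrec.nat_div.comp Primrec.snd (Primrec.const 2))
  refine isComputable_iff.2 ⟨_, Primrec.ite (Primrec.eq.comp (Primrec.nat_mod.comp Primrec.snd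
    (Primrec.const 2)) (Primrec.const 0)) (ha.comp hdiv) (hb.comp hdiv), fun p x hp => ?_⟩
  obtain ⟨s, hs, hs'⟩ := ha' p x hp
  obtain ⟨t, ht, ht'⟩ := hb' p x hp
  exact ⟨s.pair t, hs.pair ht, s, t, rfl, hs', ht'⟩

theorem isComputable_fst : IsComputable (X.prod Y) X (fun a => a.1) := by
  refine isComputable_of_modulus (N := fun k => 2 * k + 1) (G := fun a => a.1.getD (2 * a.2) false)
    (Primrec.succ.comp (Primrec.nat_mul.comp (Primrec.const 2) Primrec.id))
    ((Primrec.list_getD false).comp Primrec.fst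
      (Primrec.nat_mul.comp (Primrec.const 2) Primrec.snd)) ?_
  rintro _ a ⟨p, q, rfl, hp, -⟩
  refine ⟨p, hp, fun m k hk => ?_⟩
  rw [Cantor.getD_initial _ (by omega), Cantor.pair_even]

theorem isComputable_snd : IsComputable (X.prod Y) Y (fun a => a.2) := by
  refine isComputable_of_modulus (N := fun k => 2 * k + 2)
    (G := fun a => a.1.getD (2 * a.2 + 1) false)
    (Primrec.succ.comp (Primrec.succ.comp (Primrec.nat_mul.comp (Primrec.const 2) Primrec.id)))
    ((Primrec.list_getD false).comp Primrec.fst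
      (Primrec.succ.comp (Primrec.nat_mul.comp (Primrec.const 2) Primrec.snd))) ?_
  rintro _ a ⟨p, q, rfl, -, hq⟩
  refine ⟨q, hq, fun m k hk => ?_⟩
  rw [Cantor.getD_initial _ (by omega), Cantor.pair_odd]

/-! ### Sierpiński space -/

theorem isComputable_or :
    IsComputable (sierpinski.prod sierpinski) sierpinski (fun a => (a.1 ∨ a.2 : Prop)) := by
  refine isComputable_of_modulus (N := fun k => k + 1) (G := fun a => a.1.getD a.2 false)
    Primrec.succ ((Primrec.list_getD false).comp Primrec.fst Primrec.snd) ?_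
  rintro _ a ⟨p, q, rfl, hp, hq⟩
  -- The identity is a realizer: the interleaving contains a `true` iff one of the two sequences
  -- does.
  refine ⟨p.pair q, ?_, fun m k hk => Cantor.getD_initial _ hk⟩
  change (a.1 ∨ a.2 : Prop) ↔ _
  have hp : a.1 ↔ ∃ n, p n = true := hp
  have hq : a.2 ↔ ∃ n, q n = true := hq
  rw [hp, hq]
  constructor
  · rintro (⟨n, hn⟩ | ⟨n, hn⟩)
    · exact ⟨2 * n, by rwa [Cantor.pair_even]⟩
    · exact ⟨2 * n + 1, by rwa [Cantor.pair_odd]⟩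
  · rintro ⟨n, hn⟩
    rcases Nat.even_or_odd' n with ⟨k, rfl | rfl⟩
    · exact Or.inl ⟨k, by rwa [Cantor.pair_even] at hn⟩
    · exact Or.inr ⟨k, by rwa [Cantor.pair_odd] at hn⟩

theorem isComputable_and :
    IsComputable (sierpinski.prod sierpinski) sierpinski (fun a => (a.1 ∧ a.2 : Prop)) := by
  have hu : Primrec fun a : List Bool × ℕ => a.2.unpair := Primrec.unpair.comp Primrec.snd
  refine isComputable_of_modulus (N := fun k => 2 * k + 2)
    (G := fun a => a.1.getD (2 * a.2.unpair.1) false && a.1.getD (2 * a.2.unpair.2 + 1) false)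
    (Primrec.succ.comp (Primrec.succ.comp (Primrec.nat_mul.comp (Primrec.const 2) Primrec.id)))
    (Primrec.and.comp
      ((Primrec.list_getD false).comp Primrec.fst
        (Primrec.nat_mul.comp (Primrec.const 2) (Primrec.fst.comp hu)))
      ((Primrec.list_getD false).comp Primrec.fst
        (Primrec.succ.comp (Primrec.nat_mul.comp (Primrec.const 2) (Primrec.snd.comp hu))))) ?_
  rintro _ a ⟨p, q, rfl, hp, hq⟩
  -- Cell `⟨i, j⟩` tests `p i` and `q j`. Since `i, j ≤ ⟨i, j⟩`, cell `k` needs only `2 * k + 2`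
  -- symbols of the tape.
  refine ⟨fun k => p k.unpair.1 && q k.unpair.2, ?_, fun m k hk => ?_⟩
  · change (a.1 ∧ a.2 : Prop) ↔ _
    have hp : a.1 ↔ ∃ n, p n = true := hp
    have hq : a.2 ↔ ∃ n, q n = true := hq
    rw [hp, hq]
    constructor
    · rintro ⟨⟨i, hi⟩, ⟨j, hj⟩⟩
      exact ⟨Nat.pair i j, by simp [hi, hj]⟩
    · rintro ⟨n, hn⟩
      rw [Bool.and_eq_true] at hn
      exact ⟨⟨_, hn.1⟩, ⟨_, hn.2⟩⟩
  · have h1 := Nat.unpair_left_le k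
    have h2 := Nat.unpair_right_le k
    dsimp only
    rw [Cantor.getD_initial _ (by omega), Cantor.getD_initial _ (by omega), Cantor.pair_even,
      Cantor.pair_odd]

theorem _root_.Cantor.prepend_zero (n i : ℕ) :
    Cantor.prepend n (fun _ => false) i = decide (i = n) := by
  simp only [Cantor.prepend]
  split_ifs with h1 h2
  · simp; omega
  · simp [h2]
  · simp [h2]

/-- The word that interleaves `w` with the first `w.length` symbols of the name of `n`. -/
def pairNatWord (w : List Bool) (n : ℕ) : List Bool :=
  (List.range (2 * w.length)).map fun j =>
    if j % 2 = 0 then w.getD (j / 2) false else decide (j / 2 = n)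

theorem primrec_pairNatWord : Primrec₂ pairNatWord := by
  have hj : Primrec fun a : (List Bool × ℕ) × ℕ => a.2 / 2 :=
    Primrec.nat_div.comp Primrec.snd (Primrec.const 2)
  exact Primrec.list_map (Primrec.list_range.comp (Primrec.nat_mul.comp (Primrec.const 2)
      (Primrec.list_length.comp Primrec.fst)))
    (Primrec.ite (Primrec.eq.comp (Primrec.nat_mod.comp Primrec.snd (Primrec.const 2))
        (Primrec.const 0))
      ((Primrec.list_getD false).comp (Primrec.fst.comp Primrec.fst) hj)
      (PrimrecPred.decide (Primrec.eq.comp hj (Primrec.snd.comp Primrec.fst))))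

theorem pairNatWord_initial (p : Cantor) (l n : ℕ) :
    pairNatWord (p.initial l) n = (p.pair (Cantor.prepend n fun _ => false)).initial (2 * l) := by
  rw [pairNatWord, Cantor.length_initial]
  refine List.map_congr_left fun j hj => ?_
  rw [List.mem_range] at hj
  simp only [Cantor.pair, Cantor.prepend_zero]
  split_ifs
  · rw [Cantor.getD_initial _ (by omega)]
  · rfl

/-- Dovetailing: cell `⟨n, l⟩` records whether the program for `P`, fed with `l` symbols of the name
of `x` and `l` of the name of `n`, has already output a `true`. -/
theorem IsComputable.exists_nat {P : W → ℕ → Prop}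
    (hP : IsComputable (W.prod nat) sierpinski (fun a => (P a.1 a.2 : Prop))) :
    IsComputable W sierpinski (fun x => (∃ n, P x n : Prop)) := by
  obtain ⟨g, hg, h⟩ := isComputable_iff.1 hP
  let out : List Bool × ℕ → List Bool := fun a =>
    -- Cutting the input to `l ≤ ⟨n, l⟩` symbols makes cell `k` depend on the first `k` symbols
    -- only.
    outputPrefix g (pairNatWord (a.1.take a.2.unpair.2) a.2.unpair.1)
  have hout : Primrec out := by
    have hu : Primrec fun a : List Bool × ℕ => a.2.unpair := Primrec.unpair.comp Primrec.snd
    exact (primrec_outputPrefix hg).comp (primrec_pairNatWord.comp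
      (Primrec.list_take.comp (Primrec.snd.comp hu) Primrec.fst) (Primrec.fst.comp hu))
  refine isComputable_of_modulus (N := fun k => k)
    (G := fun a => decide ((out a).idxOf true < (out a).length)) Primrec.id
    (PrimrecPred.decide (Primrec.nat_lt.comp (Primrec.list_idxOf.comp (Primrec.const true) hout)
      (Primrec.list_length.comp hout))) ?_
  intro p x hp
  refine ⟨fun k => decide (true ∈ outputPrefix g
    ((p.pair (Cantor.prepend k.unpair.1 fun _ => false)).initial (2 * k.unpair.2))), ?_, ?_⟩
  · change (∃ n, P x n) ↔ _
    have hn : ∀ n, ∃ s, Approximates g (p.pair (Cantor.prepend n fun _ => false)) s ∧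
        (P x n ↔ ∃ k, s k = true) := fun n =>
      h (p.pair (Cantor.prepend n fun _ => false)) (x, n) ⟨p, _, rfl, hp, rfl⟩
    constructor
    · rintro ⟨n, hx⟩
      obtain ⟨s, hs, hs'⟩ := hn n
      obtain ⟨k, hk⟩ := hs'.1 hx
      obtain ⟨l, hl, hl'⟩ := hs.exists_tendsto
      obtain ⟨m, hkm⟩ := ((hl.comp (tendsto_id.const_mul_atTop' (two_pos : (0 : ℕ) < 2))).eventually
        (eventually_gt_atTop k)).exists
      refine ⟨Nat.pair n m, ?_⟩
      simp only [Nat.unpair_pair, decide_eq_true_eq, hl']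
      exact List.mem_map.2 ⟨k, List.mem_range.2 hkm, hk⟩
    · rintro ⟨k, hk⟩
      rw [decide_eq_true_eq] at hk
      obtain ⟨s, hs, hs'⟩ := hn k.unpair.1
      obtain ⟨l, hl⟩ := hs.outputPrefix_initial (2 * k.unpair.2)
      rw [hl] at hk
      obtain ⟨i, -, hi⟩ := List.mem_map.1 hk
      exact ⟨_, hs'.2 ⟨i, hi⟩⟩
  · intro m k hk
    have hu := Nat.unpair_right_le k
    have ho : out (p.initial m, k) = outputPrefix g
        ((p.pair (Cantor.prepend k.unpair.1 fun _ => false)).initial (2 * k.unpair.2)) := by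
      simp only [out]
      rw [Cantor.take_initial p (by omega), pairNatWord_initial]
    simp only [ho, List.idxOf_lt_length_iff]

/-! ### Currying and evaluation -/

/-- Function names carry an oracle, so currying needs no new program: `n` is the number of a machine
realizing `f`, and the name of `x` is the oracle. -/
theorem exists_prepend_isFunName {f : W × X → Y} (hf : IsComputable (W.prod X) Y f) :
    ∃ n, ∀ r x, W.IsName r x → IsFunName X Y (Cantor.prepend n r) (fun y => f (x, y)) := by
  obtain ⟨c, hc⟩ := hf
  refine ⟨Encodable.encode c, fun r x hr => ⟨_, r, rfl, fun q y z hq hz => ?_⟩⟩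
  obtain ⟨s, hs, hs'⟩ := hc (r.pair q) (x, y) z ⟨r, q, rfl, hr, hq⟩ hz
  exact ⟨s, by rwa [Denumerable.ofNat_encode], hs'⟩

/-- A program for the map `⟨0^n 1 p, q⟩ ↦ 0^n 1 ⟨p, q⟩`. -/
def uncurryBit (a : List Bool × ℕ) : Bool :=
  -- If the first `a.2 + 1` symbols of `0^n 1 p` contain no `true`, this is `a.2 + 1`, and the bit
  -- is correctly `false`.
  let n := ((List.range (a.2 + 1)).map fun i => a.1.getD (2 * i) false).idxOf true
  if a.2 < n then false else if a.2 = n then true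
  -- With `j = a.2 - (n + 1)`, an even `j` asks for `p (j / 2)`, which is symbol `n + 1 + j / 2` of
  -- the first component; an odd `j` asks for `q (j / 2)`.
  else if (a.2 - (n + 1)) % 2 = 0 then a.1.getD (2 * (n + 1 + (a.2 - (n + 1)) / 2)) false
  else a.1.getD (2 * ((a.2 - (n + 1)) / 2) + 1) false

theorem primrec_uncurryBit : Primrec uncurryBit := by
  have hn : Primrec fun a : List Bool × ℕ =>
      ((List.range (a.2 + 1)).map fun i => a.1.getD (2 * i) false).idxOf true :=
    Primrec.list_idxOf.comp (Primrec.const true) (Primrec.list_map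
      (Primrec.list_range.comp (Primrec.succ.comp Primrec.snd))
      ((Primrec.list_getD false).comp (Primrec.fst.comp Primrec.fst)
        (Primrec.nat_mul.comp (Primrec.const 2) Primrec.snd)))
  have hk : Primrec fun a : List Bool × ℕ => a.2 := Primrec.snd
  have hd := Primrec.nat_sub.comp hk (Primrec.succ.comp hn)
  have hh := Primrec.nat_div.comp hd (Primrec.const 2)
  exact Primrec.ite (Primrec.nat_lt.comp hk hn) (Primrec.const false)
    (Primrec.ite (Primrec.eq.comp hk hn) (Primrec.const true)
      (Primrec.ite (Primrec.eq.comp (Primrec.nat_mod.comp hd (Primrec.const 2)) (Primrec.const 0))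
        ((Primrec.list_getD false).comp Primrec.fst (Primrec.nat_mul.comp (Primrec.const 2)
          (Primrec.nat_add.comp (Primrec.succ.comp hn) hh)))
        ((Primrec.list_getD false).comp Primrec.fst
          (Primrec.succ.comp (Primrec.nat_mul.comp (Primrec.const 2) hh)))))

theorem uncurryBit_initial (n : ℕ) (p q : Cantor) {m k : ℕ} (hk : 2 * k + 2 ≤ m) :
    uncurryBit (((Cantor.prepend n p).pair q).initial m, k) =
      Cantor.prepend n (p.pair q) k := by
  have h1 : (List.range (k + 1)).map
      (fun i => (((Cantor.prepend n p).pair q).initial m).getD (2 * i) false) =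
      (Cantor.prepend n p).initial (k + 1) := by
    refine List.map_congr_left fun i hi => ?_
    rw [List.mem_range] at hi
    rw [Cantor.getD_initial _ (by omega), Cantor.pair_even]
  simp only [uncurryBit, h1]
  rcases lt_or_ge k n with hkn | hkn
  · rw [Cantor.idxOf_initial_prepend_of_le p hkn]
    simp [Cantor.prepend, hkn]
  · obtain ⟨j, rfl⟩ : ∃ j, k = n + j := ⟨k - n, by omega⟩
    rw [show n + j + 1 = n + 1 + j by omega, Cantor.idxOf_initial_prepend]
    simp only [Cantor.prepend]
    split_ifs with h2 h3 h4
    · rfl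
    · rfl
    · rw [Cantor.getD_initial _ (by omega), Cantor.pair_even]
      simp only [Cantor.pair, Cantor.prepend, if_pos h4]
      rw [if_neg (by omega), if_neg (by omega)]
      congr 1
      omega
    · rw [Cantor.getD_initial _ (by omega), Cantor.pair_odd]
      simp only [Cantor.pair, if_neg h4]

/-- Moving `0^n 1` to the front of the whole tape reduces evaluation to the universal program. The
program is uniform in the spaces, so it serves `𝒞(X, Y)`, `𝒪(X)` and `𝒱(X)` alike, whose names are
all function names. -/
theorem exists_evaluation_program : ∃ g, Primrec g ∧ ∀ {X : RepSpace.{u}} {Y : RepSpace.{v}}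
    {f : X → Y} {r q : Cantor} {x : X}, IsFunName X Y r f → X.IsName q x →
      ∃ s, Approximates g (r.pair q) s ∧ Y.IsName s (f x) := by
  have h := primrec_modulus (N := fun k => 2 * k + 2)
    (Primrec.succ.comp (Primrec.succ.comp (Primrec.nat_mul.comp (Primrec.const 2) Primrec.id)))
    primrec_uncurryBit
  refine ⟨_, primrec_universalProgram.comp (((primrec_outputPrefix h).comp Primrec.fst).pair
    Primrec.snd), ?_⟩
  rintro X Y f r q x ⟨n, p, rfl, hp⟩ hq
  obtain ⟨s, hs, hs'⟩ := hp q x _ hq (Part.mem_some _)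
  exact ⟨s, (approximates_universalProgram hs).comp
    (Approximates.of_modulus fun m k hk => uncurryBit_initial n p q hk), hs'⟩

theorem isComputable_eval :
    IsComputable ((X.functions Y).prod X) Y (fun a => a.1.1 a.2) := by
  obtain ⟨g, hg, h⟩ := exists_evaluation_program
  refine isComputable_iff.2 ⟨g, hg, ?_⟩
  rintro _ a ⟨r, q, rfl, hr, hq⟩
  exact h hr hq

theorem isComputable_mem :
    IsComputable (X.opens.prod X) sierpinski (fun a => (a.2 ∈ a.1.1 : Prop)) := by
  obtain ⟨g, hg, h⟩ := exists_evaluation_program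
  refine isComputable_iff.2 ⟨g, hg, ?_⟩
  rintro _ a ⟨r, q, rfl, hr, hq⟩
  exact h hr hq

theorem isComputable_meets :
    IsComputable (X.overts.prod X.opens) sierpinski (fun a => ((a.2.1 ∩ a.1.1).Nonempty : Prop)) := by
  obtain ⟨g, hg, h⟩ := exists_evaluation_program
  refine isComputable_iff.2 ⟨g, hg, ?_⟩
  rintro _ a ⟨r, q, rfl, hr, hq⟩
  exact h hr hq

/-! ### Computable maps into `𝒪(X)` and `𝒱(X)` -/

/-- The sections of a semidecidable relation, as open sets. -/
def sectionOpen (P : W × X → Prop) (hP : IsComputable (W.prod X) sierpinski P) (x : W) : X.opens :=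
  ⟨{y | P (x, y)}, by
    obtain ⟨n, hn⟩ := exists_prepend_isFunName hP
    obtain ⟨r, hr⟩ := W.surj x
    exact ⟨_, hn r x hr⟩⟩

theorem isComputablePartial_prepend {f : X →. Y} (n : ℕ)
    (h : ∀ r x y, X.IsName r x → y ∈ f x → Y.IsName (Cantor.prepend n r) y) :
    IsComputablePartial X Y f :=
  isComputablePartial_iff.2 ⟨_, primrec_prependProgram n, fun p x y hp hy =>
    ⟨_, approximates_prependProgram n p, h p x y hp hy⟩⟩

theorem isComputable_sectionOpen {P : W × X → Prop} (hP : IsComputable (W.prod X) sierpinski P) :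
    IsComputable W X.opens (sectionOpen P hP) := by
  obtain ⟨n, hn⟩ := exists_prepend_isFunName hP
  refine isComputablePartial_prepend n fun r x y hr hy => ?_
  obtain rfl := Part.mem_some_iff.1 hy
  exact hn r x hr

/-- A map into `𝒱(X)` is computable if the open sets that meet its value can be semidecided. -/
theorem isComputablePartial_overts {f : W →. X.overts} {P : W × X.opens → Prop}
    (hP : IsComputable (W.prod X.opens) sierpinski P)
    (h : ∀ x A, A ∈ f x → ∀ U : X.opens, (U.1 ∩ A.1).Nonempty ↔ P (x, U)) :
    IsComputablePartial W X.overts f := by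
  obtain ⟨n, hn⟩ := exists_prepend_isFunName hP
  refine isComputablePartial_prepend n fun r x A hr hA => ?_
  have : X.opens.char (X.meeting A.1) = fun U => P (x, U) :=
    funext fun U => propext (h x A hA U)
  change IsFunName X.opens sierpinski _ (X.opens.char (X.meeting A.1))
  rw [this]
  exact hn r x hr

/-- The elements of `𝒪(X)` are open in the quotient topology. -/
theorem isOpen_of_opens (U : X.opens) : @IsOpen _ X.topology U.1 := by
  obtain ⟨_, n, p, rfl, hU⟩ := U.2
  refine isOpen_coinduced.2 (isOpen_iff_forall_mem_open.2 ?_)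
  rintro ⟨q, x, hq⟩ hx
  rw [Set.mem_preimage, X.delta_eq hq] at hx
  obtain ⟨s, hs, hs'⟩ := hU q x _ hq (Part.mem_some _)
  obtain ⟨k, hk⟩ := hs'.1 hx
  obtain ⟨m, hm⟩ := (mem_machineMap.1 hs k).exists_prefix
  -- The `true` in cell `k` was written after finitely many tape symbols, so it persists for all
  -- names that agree with `q` that far.
  refine ⟨Subtype.val ⁻¹' {q' : Cantor | ∀ i < m, q' i = q i}, ?_,
    (Cantor.isOpen_agree _ _).preimage continuous_subtype_val, fun i _ => rfl⟩
  rintro ⟨q', x', hq'⟩ hr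
  rw [Set.mem_preimage, X.delta_eq hq']
  obtain ⟨t, ht, ht'⟩ := hU q' x' _ hq' (Part.mem_some _)
  refine ht'.2 ⟨k, ?_⟩
  rw [← hk]
  refine (mem_machineMap.1 ht k).unique (hm _ fun i hi => ?_)
  simp only [Cantor.pair]
  split
  · rfl
  · exact hr _ (by omega)

theorem nonempty_inter_cl (U : X.opens) (A : Set X) :
    (U.1 ∩ (X.cl A).1).Nonempty ↔ (U.1 ∩ A).Nonempty := by
  rw [Set.inter_comm, Set.inter_comm U.1 A]
  exact @closure_inter_open_nonempty_iff X X.topology A U.1 (isOpen_of_opens U)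

/-- A map into `𝒱(X)` whose values are closures of the sets `S x` is computable if the open sets
that meet `S x` can be semidecided. -/
theorem isComputable_cl {S : W → Set X} {P : W × X.opens → Prop}
    (hP : IsComputable (W.prod X.opens) sierpinski P)
    (h : ∀ x (U : X.opens), (U.1 ∩ S x).Nonempty ↔ P (x, U)) :
    IsComputable W X.overts (fun x => X.cl (S x)) := by
  refine isComputablePartial_overts hP fun x A hA U => ?_
  obtain rfl := Part.mem_some_iff.1 hA
  rw [nonempty_inter_cl, h]

/-- Closed sets that meet the same open sets coincide. -/
theorem overts_ext {A B : X.overts}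
    (h : ∀ U : X.opens, (U.1 ∩ A.1).Nonempty ↔ (U.1 ∩ B.1).Nonempty) : A = B := by
  obtain ⟨r, hr⟩ := X.overts.surj A
  refine X.overts.unique hr ?_
  have : X.opens.char (X.meeting B.1) = X.opens.char (X.meeting A.1) :=
    funext fun U => propext (h U).symm
  change IsFunName X.opens sierpinski r (X.opens.char (X.meeting B.1))
  rw [this]
  exact hr

end RepSpace

namespace RepSpace

variable {X : RepSpace.{u}} {Y : RepSpace.{v}} {Z : RepSpace.{w}}

/-! ### Operations on open sets -/

theorem isComputable_mem_inter : IsComputable ((X.opens.prod X.opens).prod X) sierpinski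
    (fun a => (a.2 ∈ a.1.1.1 ∧ a.2 ∈ a.1.2.1 : Prop)) :=
  isComputable_and.comp
    ((isComputable_mem.comp ((isComputable_fst.comp isComputable_fst).pair isComputable_snd)).pair
      (isComputable_mem.comp ((isComputable_snd.comp isComputable_fst).pair isComputable_snd)))

/-- Intersection of open sets. -/
def interOpen : X.opens.prod X.opens → X.opens := sectionOpen _ isComputable_mem_inter

theorem isComputable_interOpen : IsComputable (X.opens.prod X.opens) X.opens interOpen :=
  isComputable_sectionOpen _

theorem interOpen_val (U V : X.opens) : (interOpen (U, V)).1 = U.1 ∩ V.1 := rfl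

theorem isComputable_mem_cylinder : IsComputable (X.opens.prod (X.prod Y)) sierpinski
    (fun a => (a.2.1 ∈ a.1.1 : Prop)) :=
  isComputable_mem.comp (isComputable_fst.pair (isComputable_fst.comp isComputable_snd))

/-- The open set `U × Y` of `X × Y`. -/
def cylinderOpen (Y : RepSpace.{v}) : X.opens → (X.prod Y).opens :=
  sectionOpen _ isComputable_mem_cylinder

theorem isComputable_cylinderOpen : IsComputable X.opens (X.prod Y).opens (cylinderOpen Y) :=
  isComputable_sectionOpen _

theorem isComputable_mem_preimage : IsComputable (((X.functions Y).prod Y.opens).prod X) sierpinski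
    (fun a => (a.1.1.1 a.2 ∈ a.1.2.1 : Prop)) :=
  isComputable_mem.comp ((isComputable_snd.comp isComputable_fst).pair
    (isComputable_eval.comp ((isComputable_fst.comp isComputable_fst).pair isComputable_snd)))

/-- The preimage of an open set under a continuous function. -/
def preimageOpen : (X.functions Y).prod Y.opens → X.opens := sectionOpen _ isComputable_mem_preimage

theorem isComputable_preimageOpen :
    IsComputable ((X.functions Y).prod Y.opens) X.opens preimageOpen :=
  isComputable_sectionOpen _

theorem preimageOpen_val (f : X.functions Y) (U : Y.opens) :
    (preimageOpen (f, U)).1 = f.1 ⁻¹' U.1 := rfl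

/-! ### Operations on overt sets -/

/-- `V` meets `U` iff `U ∩ V` is non-empty, which overtness of `Z` semidecides. -/
theorem isComputable_cl_open (hZ : Z.ComputablyOvert) :
    IsComputable Z.opens Z.overts (fun U => Z.cl U.1) :=
  isComputable_cl (hZ.comp isComputable_interOpen) fun U V => by
    rw [interOpen_val, Set.inter_comm]

theorem isComputable_cl_singleton : IsComputable X X.overts (fun x => X.cl {x}) :=
  isComputable_cl (isComputable_mem.comp (isComputable_snd.pair isComputable_fst)) fun x U => by
    rw [Set.inter_singleton_nonempty]

theorem isComputable_union :
    IsComputable (X.overts.prod X.overts) X.overts (fun A => X.union A.1 A.2) :=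
  isComputablePartial_overts (isComputable_or.comp
    ((isComputable_meets.comp ((isComputable_fst.comp isComputable_fst).pair
      isComputable_snd)).pair (isComputable_meets.comp
        ((isComputable_snd.comp isComputable_fst).pair isComputable_snd)))) fun A B hB U => by
    obtain rfl := Part.mem_some_iff.1 hB
    change (U.1 ∩ (A.1.1 ∪ A.2.1)).Nonempty ↔ _
    rw [Set.inter_union_distrib_left, Set.union_nonempty]

theorem isComputable_cl_iUnion : IsComputable (nat.functions X.overts) X.overts
    (fun A => X.cl (⋃ n, (A.1 n).1)) :=
  isComputable_cl (IsComputable.exists_nat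
    (P := fun (a : (nat.functions X.overts).prod X.opens) n => (a.2.1 ∩ (a.1.1 n).1).Nonempty)
    (isComputable_meets.comp ((isComputable_eval.comp
      ((isComputable_fst.comp isComputable_fst).pair isComputable_snd)).pair
        (isComputable_snd.comp isComputable_fst)))) fun A U => by
    rw [Set.inter_iUnion, Set.nonempty_iUnion]
    rfl

theorem isComputable_cl_inter : IsComputable (X.overts.prod X.opens) X.overts
    (fun P => X.cl (P.1.1 ∩ P.2.1)) :=
  isComputable_cl (isComputable_meets.comp ((isComputable_fst.comp isComputable_fst).pair
    (isComputable_interOpen.comp (isComputable_snd.pair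
      (isComputable_snd.comp isComputable_fst))))) fun P U => by
    rw [interOpen_val, Set.inter_assoc, Set.inter_comm P.1.1]

theorem isComputable_cl_image_fst :
    IsComputable (X.prod Y).overts X.overts (fun A => X.cl (Prod.fst '' A.1)) :=
  isComputable_cl (isComputable_meets.comp (isComputable_fst.pair
    (isComputable_cylinderOpen.comp isComputable_snd))) fun A U => by
    rw [Set.inter_comm]
    refine (Set.image_inter_nonempty_iff (f := (Prod.fst : X × Y → X))).trans ?_
    rw [Set.inter_comm]
    rfl

theorem isComputable_cl_image : IsComputable ((X.functions Y).prod X.overts) Y.overts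
    (fun P => Y.cl (P.1.1 '' P.2.1)) :=
  isComputable_cl (isComputable_meets.comp ((isComputable_snd.comp isComputable_fst).pair
    (isComputable_preimageOpen.comp ((isComputable_fst.comp isComputable_fst).pair
      isComputable_snd)))) fun P U => by
    rw [preimageOpen_val, Set.inter_comm, Set.image_inter_nonempty_iff, Set.inter_comm]

/-- The partial map `(F, A) ↦ closure (f⁻¹ A)`, where `F` is the image map of `f`. -/
noncomputable def clPreimage (X : RepSpace.{u}) (Y : RepSpace.{v}) :
    (X.opens.functions Y.opens).prod Y.overts →. X.overts := fun P =>
  ⟨∃ f : X → Y, ∀ U : X.opens, (P.1.1 U).1 = f '' U.1, fun h => X.cl (h.choose ⁻¹' P.2.1)⟩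

/-- The right-hand side involves `f` only through `F`; this yields both computability and
independence of the choice of `f`. -/
theorem nonempty_inter_cl_preimage {F : X.opens → Y.opens} {f : X → Y}
    (hf : ∀ U : X.opens, (F U).1 = f '' U.1) (A : Set Y) (U : X.opens) :
    (U.1 ∩ (X.cl (f ⁻¹' A)).1).Nonempty ↔ ((F U).1 ∩ A).Nonempty := by
  rw [nonempty_inter_cl, hf, Set.image_inter_nonempty_iff]

theorem mem_clPreimage {F : X.opens.functions Y.opens} {A : Y.overts} {B : X.overts} :
    B ∈ clPreimage X Y (F, A) ↔
      ∃ f : X → Y, (∀ U : X.opens, (F.1 U).1 = f '' U.1) ∧ B = X.cl (f ⁻¹' A.1) := by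
  constructor
  · rintro ⟨h, rfl⟩
    exact ⟨h.choose, h.choose_spec, rfl⟩
  · rintro ⟨f, hf, rfl⟩
    refine ⟨⟨f, hf⟩, overts_ext fun U => ?_⟩
    have h : ∃ f : X → Y, ∀ U : X.opens, (F.1 U).1 = f '' U.1 := ⟨f, hf⟩
    exact (nonempty_inter_cl_preimage h.choose_spec A.1 U).trans
      (nonempty_inter_cl_preimage hf A.1 U).symm

theorem isComputablePartial_clPreimage : IsComputablePartial
    ((X.opens.functions Y.opens).prod Y.overts) X.overts (clPreimage X Y) :=
  isComputablePartial_overts (isComputable_meets.comp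
    ((isComputable_snd.comp isComputable_fst).pair (isComputable_eval.comp
      ((isComputable_fst.comp isComputable_fst).pair isComputable_snd)))) fun P B hB U => by
    obtain ⟨f, hf, rfl⟩ := mem_clPreimage.1 hB
    exact nonempty_inter_cl_preimage hf P.2.1 U

end RepSpace

theorem proposition22 (X : RepSpace.{u}) (Y : RepSpace.{v}) (Z : RepSpace.{w})
    (hZ : Z.ComputablyOvert) :
    -- closure of open sets
    RepSpace.IsComputable Z.opens Z.overts (fun U => Z.cl U.1) ∧
    -- closure of points
    RepSpace.IsComputable X X.overts (fun x => X.cl {x}) ∧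
    -- binary union
    RepSpace.IsComputable (X.overts.prod X.overts) X.overts (fun A => X.union A.1 A.2) ∧
    -- closure of countable union
    RepSpace.IsComputable (RepSpace.nat.functions X.overts) X.overts
      (fun A => X.cl (⋃ n, (A.1 n).1)) ∧
    -- closure of the intersection with an open set
    RepSpace.IsComputable (X.overts.prod X.opens) X.overts (fun P => X.cl (P.1.1 ∩ P.2.1)) ∧
    -- closure of the first projection
    RepSpace.IsComputable (X.prod Y).overts X.overts (fun A => X.cl (Prod.fst '' A.1)) ∧
    -- closure of the image
    RepSpace.IsComputable ((X.functions Y).prod X.overts) Y.overts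
      (fun P => Y.cl (P.1.1 '' P.2.1)) ∧
    -- closure of the preimage, where `f` is given by its open image map `U ↦ f[U]`
    ∃ G : (X.opens.functions Y.opens).prod Y.overts →. X.overts,
      (∀ (F : X.opens.functions Y.opens) (A : Y.overts) (B : X.overts), B ∈ G (F, A) ↔
        ∃ f : X → Y, (∀ U : X.opens, (F.1 U).1 = f '' U.1) ∧ B = X.cl (f ⁻¹' A.1)) ∧
      RepSpace.IsComputablePartial ((X.opens.functions Y.opens).prod Y.overts) X.overts G := by
  exact ⟨RepSpace.isComputable_cl_open hZ, RepSpace.isComputable_cl_singleton,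
    RepSpace.isComputable_union, RepSpace.isComputable_cl_iUnion, RepSpace.isComputable_cl_inter,
    RepSpace.isComputable_cl_image_fst, RepSpace.isComputable_cl_image,
    RepSpace.clPreimage X Y, fun _ _ _ => RepSpace.mem_clPreimage,
    RepSpace.isComputablePartial_clPreimage⟩
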